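/- Let $k$ and $n$ be positive integers with $k\le n$. Let $\mathbb{C}[S_k]$ be the group algebra of the symmetric group, i.e. the space of all functions $S_k\to\mathbb{C}$ with the convolution product \[(f_1*f_2)(\pi)=\sum_{\sigma\in S_k} f_1(\sigma)\,f_2(\sigma^{-1}\pi),\] and let $\delta_{e}$ be the function equal to $1$ at the identity permutation and $0$ elsewhere. Write $\mathrm{fix}(\sigma)$ for the number of fixed points of $\sigma\in S_k$, $a^{\uparrow m}=a(a+1)\cdots(a+m-1)$ and $a^{\downarrow m}=a(a-1)\cdots(a-m+1)$ (both equal to $1$ for $m=0$). For $m\ge1$, the ascension function is \[A_{k,m}(\sigma)=\sum_{t=0}^{\mathrm{fix}(\sigma)}(-1)^{k-t}\binom{\mathrm{fix}(\sigma)}{t}\frac{1}{m^{\uparrow(k-t)}},\] and the descension function is \[D_{k,n}(\sigma)=\mathrm{sgn}(\sigma)\sum_{t=0}^{\mathrm{fix}(\sigma)}\binom{\mathrm{fix}(\sigma)}{t}\frac{1}{n^{\downarrow(k-t)}}.\] For $m\ge k$, the unitary Weingarten function is \[\mathrm{Wg}_{k,m}(\pi)=\mathbb{E}\left[u_{11}u_{22}\cdots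 u_{kk}\,\overline{u_{1\pi(1)}u_{2\pi(2)}\cdots u_{k\pi(k)}}\right]\qquad(\pi\in S_k),\] where $U=(u_{ij})$ is a Haar-distributed random matrix in the unitary group $\mathrm{U}(m)$. Then \[A_{k,n+1}*D_{k,n}=\delta_{e}\qquad\text{and}\qquad \mathrm{Wg}_{k,n}=D_{k,n}*\mathrm{Wg}_{k,n+1}.\] -/

import Mathlib

namespace WgCalc

noncomputable section

/-- The number of fixed points of a permutation of `{1, …, k}`. -/
def fixCount {k : ℕ} (σ : Equiv.Perm (Fin k)) : ℕ :=
  (Finset.univ.filter fun i : Fin k => σ i = i).card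

/-- The convolution product on the group algebra of the symmetric group, whose elements are
the complex-valued functions on the group. -/
def conv {k : ℕ} (f g : Equiv.Perm (Fin k) → ℂ) : Equiv.Perm (Fin k) → ℂ :=
  fun π => ∑ σ : Equiv.Perm (Fin k), f σ * g (σ⁻¹ * π)

/-- The Dirac function at the identity permutation. -/
def diracId (k : ℕ) : Equiv.Perm (Fin k) → ℂ :=
  fun σ => if σ = 1 then 1 else 0

/-- The ascension function. Here `n.ascFactorial m = n (n + 1) ⋯ (n + m - 1)`. -/
def ascension (k n : ℕ) : Equiv.Perm (Fin k) → ℂ :=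
  fun σ => ∑ t ∈ Finset.range (fixCount σ + 1),
    (-1 : ℂ) ^ (k - t) * ((fixCount σ).choose t : ℂ) * (1 / (n.ascFactorial (k - t) : ℂ))

/-- The descension function. Here `n.descFactorial m = n (n - 1) ⋯ (n - m + 1)`, which does not
vanish for `m ≤ k ≤ n`. -/
def descension (k n : ℕ) : Equiv.Perm (Fin k) → ℂ :=
  fun σ => ((Equiv.Perm.sign σ : ℤ) : ℂ) * ∑ t ∈ Finset.range (fixCount σ + 1),
    ((fixCount σ).choose t : ℂ) * (1 / (n.descFactorial (k - t) : ℂ))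

/-- The Borel σ-algebra of the unitary group `U(n)`. -/
instance unitaryGroupMeasurableSpace (n : ℕ) :
    MeasurableSpace (Matrix.unitaryGroup (Fin n) ℂ) :=
  borel _

instance unitaryGroupBorelSpace (n : ℕ) :
    BorelSpace (Matrix.unitaryGroup (Fin n) ℂ) :=
  ⟨rfl⟩

instance unitaryGroupCompactSpace (n : ℕ) :
    CompactSpace (Matrix.unitaryGroup (Fin n) ℂ) := by
  have hK : IsCompact (X := Matrix (Fin n) (Fin n) ℂ)
      (Set.univ.pi fun _ : Fin n => Set.univ.pi fun _ : Fin n => Metric.closedBall (0 : ℂ) 1) :=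
    isCompact_univ_pi fun _ => isCompact_univ_pi fun _ => isCompact_closedBall 0 1
  have hc : IsClosed {U : Matrix (Fin n) (Fin n) ℂ | star U * U = 1 ∧ U * star U = 1} :=
    (isClosed_eq (continuous_star.mul continuous_id) continuous_const).inter
      (isClosed_eq (continuous_id.mul continuous_star) continuous_const)
  have hsub : (Matrix.unitaryGroup (Fin n) ℂ : Set (Matrix (Fin n) (Fin n) ℂ)) ⊆
      Set.univ.pi fun _ : Fin n => Set.univ.pi fun _ : Fin n => Metric.closedBall (0 : ℂ) 1 := by
    intro U hU i _ j _
    simpa using entry_norm_bound_of_unitary hU i j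
  exact isCompact_iff_compactSpace.mp (hK.of_isClosed_subset hc hsub)

/-- The Haar measure of the compact group `U(n)`, normalized to have total mass one. -/
def unitaryHaar (n : ℕ) : MeasureTheory.Measure (Matrix.unitaryGroup (Fin n) ℂ) :=
  MeasureTheory.Measure.haarMeasure ⊤

instance unitaryHaarIsHaarMeasure (n : ℕ) : (unitaryHaar n).IsHaarMeasure := by
  unfold unitaryHaar
  infer_instance

instance unitaryHaarIsProbabilityMeasure (n : ℕ) :
    MeasureTheory.IsProbabilityMeasure (unitaryHaar n) :=
  ⟨MeasureTheory.Measure.haarMeasure_self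
    (K₀ := (⊤ : TopologicalSpace.PositiveCompacts (Matrix.unitaryGroup (Fin n) ℂ)))⟩

/-- The unitary Weingarten function for `k ≤ n`:
`Wg(π) = 𝔼[u₁₁ u₂₂ ⋯ u_{kk} conj (u_{1,π(1)} u_{2,π(2)} ⋯ u_{k,π(k)})]`,
where `U = (u_{ij})` is Haar distributed on `U(n)`. -/
def weingarten (k n : ℕ) (h : k ≤ n) : Equiv.Perm (Fin k) → ℂ :=
  fun π => ∫ U : Matrix.unitaryGroup (Fin n) ℂ,
    (∏ i : Fin k, (U : Matrix (Fin n) (Fin n) ℂ) (Fin.castLE h i) (Fin.castLE h i)) *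
      star (∏ i : Fin k, (U : Matrix (Fin n) (Fin n) ℂ) (Fin.castLE h i) (Fin.castLE h (π i)))
    ∂(unitaryHaar n)

end

end WgCalc

/-! Everything follows from one-step recursions driven by Jucys–Murphy elements. For a set S of
points and x outside S, let J be the sum of the transpositions (x y) with y in S, and extend the
functions A, D, Wg to subsets of the index set. In the group algebra, writing S' for S with x added,
(n + J) D_{S'} = (n + 1 + J) D_S, (n + 1 + J) A_{S'} = (n + J) A_S, (n + J) Wg_{n,S'} = Wg_{n,S},
and every element is 1 on the empty set. Since J commutes with D_S, induction on S gives D_S A_S = 1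
and Wg_{n,S} = D_S Wg_{n+1,S}, once n + J can be cancelled. It can, because the Weingarten recursion
exhibits it as a factor of a unit.

The first two recursions are instances of `subsetSum_recursion`. Choosing t fixed points of σ
amounts to choosing a set T, the complement of the chosen points, outside which σ is the identity.
So A and D are weighted sums over T of the symmetrizers, respectively antisymmetrizers, of T
(`toGroupAlgebra_of_fixCount`).

The third, `weingartenOn_recursion`, integrates the orthogonality of two rows of U. Summing over the
column j produces moments with a repeated column, which `integral_repeated_column` splits into two
Weingarten values. -/

namespace WgCalc

open Equiv Finset MeasureTheory

/-! ### Symmetrizers, antisymmetrizers and Jucys–Murphy elements -/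

section SymmetricSums

variable {ι R : Type*} [Fintype ι] [DecidableEq ι] [Ring R]

/-- The permutations that fix every point outside `T`. -/
def permsOn (T : Finset ι) : Finset (Perm ι) :=
  univ.filter fun σ => ∀ i, i ∉ T → σ i = i

theorem mem_permsOn {T : Finset ι} {σ : Perm ι} : σ ∈ permsOn T ↔ ∀ i, i ∉ T → σ i = i := by
  simp [permsOn]

theorem permsOn_empty : permsOn (∅ : Finset ι) = {1} := by
  ext σ
  simp [mem_permsOn, Equiv.ext_iff]

theorem swap_mem_permsOn {T : Finset ι} {x y : ι} (hx : x ∈ T) (hy : y ∈ T) :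
    swap x y ∈ permsOn T := by
  rw [mem_permsOn]
  intro i hi
  exact swap_apply_of_ne_of_ne (fun h => hi (h ▸ hx)) (fun h => hi (h ▸ hy))

theorem mul_mem_permsOn {T : Finset ι} {σ τ : Perm ι} (hσ : σ ∈ permsOn T)
    (hτ : τ ∈ permsOn T) : σ * τ ∈ permsOn T := by
  rw [mem_permsOn] at *
  intro i hi
  rw [Perm.mul_apply, hτ i hi, hσ i hi]

theorem permsOn_mono {S T : Finset ι} (h : S ⊆ T) : permsOn S ⊆ permsOn T := fun σ hσ => by
  rw [mem_permsOn] at *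
  exact fun i hi => hσ i fun hS => hi (h hS)

theorem swap_mul_mem_permsOn_iff {T : Finset ι} {x y : ι} (hx : x ∈ T) (hy : y ∈ T)
    {σ : Perm ι} : swap x y * σ ∈ permsOn T ↔ σ ∈ permsOn T := by
  have hs := swap_mem_permsOn hx hy
  refine ⟨fun h => ?_, mul_mem_permsOn hs⟩
  simpa using mul_mem_permsOn hs h

theorem apply_mem_iff_of_mem_permsOn {T : Finset ι} {σ : Perm ι} (hσ : σ ∈ permsOn T) (i : ι) :
    i ∈ T ↔ σ i ∈ T := by
  rw [mem_permsOn] at hσ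
  by_cases hi : i ∈ T
  · refine iff_of_true hi ?_
    by_contra h
    have := σ.injective (hσ _ h)
    rw [this] at h
    exact h hi
  · rw [hσ i hi]

/-- The Jucys–Murphy element attached to `x` and `S`: the sum of the transpositions `(x y)`
for `y ∈ S`. -/
def jucysMurphy (ρ : Perm ι →* R) (x : ι) (S : Finset ι) : R :=
  ∑ y ∈ S, ρ (swap x y)

/-- Conjugation by σ fixes x and permutes S, hence only permutes the transpositions in the sum. -/
theorem commute_jucysMurphy (ρ : Perm ι →* R) {S : Finset ι} {x : ι} (hx : x ∉ S) {σ : Perm ι}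
    (hσ : σ ∈ permsOn S) : Commute (ρ σ) (jucysMurphy ρ x S) := by
  rw [Commute, SemiconjBy, jucysMurphy, mul_sum, sum_mul]
  refine sum_equiv σ (fun i => apply_mem_iff_of_mem_permsOn hσ i) fun y _ => ?_
  rw [← map_mul, ← map_mul, Equiv.mul_swap_eq_swap_mul, mem_permsOn.1 hσ x hx]

variable [Algebra ℂ R]

/-- The sum of the permutations of `T`, weighted by a character. -/
def symSum (ρ : Perm ι →* R) (χ : Perm ι →* ℂ) (T : Finset ι) : R :=
  ∑ σ ∈ permsOn T, χ σ • ρ σ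

variable (ρ : Perm ι →* R) (χ : Perm ι →* ℂ)

theorem symSum_empty : symSum ρ χ ∅ = 1 := by
  simp [symSum, permsOn_empty]

theorem swap_mul_symSum {ε : ℂ} (hε : ε * ε = 1) (hχ : ∀ x y : ι, x ≠ y → χ (swap x y) = ε)
    {T : Finset ι} {x y : ι} (hx : x ∈ T) (hy : y ∈ T) (hxy : x ≠ y) :
    ρ (swap x y) * symSum ρ χ T = ε • symSum ρ χ T := by
  rw [symSum, mul_sum, smul_sum]
  refine sum_equiv (Equiv.mulLeft (swap x y)) (fun σ => ?_) fun σ _ => ?_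
  · simp [swap_mul_mem_permsOn_iff hx hy]
  · simp [hχ x y hxy, smul_smul, ← mul_assoc, hε]

/-- Conjugation by (x y) exchanges the permutations of T ∪ {x} with those of T ∪ {y} and preserves
the character. -/
theorem swap_mul_symSum_insert {T : Finset ι} {x y : ι} (hx : x ∉ T) (hy : y ∉ T) :
    ρ (swap x y) * symSum ρ χ (insert x T) = symSum ρ χ (insert y T) * ρ (swap x y) := by
  rw [symSum, symSum, mul_sum, sum_mul]
  refine sum_equiv (MulAut.conj (swap x y)).toEquiv (fun σ => ?_) fun σ _ => ?_
  · simp only [mem_permsOn, mem_insert, not_or, MulEquiv.toEquiv_eq_coe, EquivLike.coe_coe,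
      MulAut.conj_apply, swap_inv, Perm.mul_apply]
    have key : ∀ i, (i ≠ y ∧ i ∉ T) ↔ (swap x y i ≠ x ∧ swap x y i ∉ T) := by
      intro i
      rcases eq_or_ne i x with rfl | h1
      · simp [hx, hy, eq_comm]
      rcases eq_or_ne i y with rfl | h2
      · simp
      rw [swap_apply_of_ne_of_ne h1 h2]
      tauto
    constructor
    · intro h i hi
      have := (key i).1 hi
      rw [h _ this, swap_apply_self]
    · intro h i hi
      have := h (swap x y i) ((key _).2 (by rwa [swap_apply_self]))
      rw [swap_apply_self] at this
      exact (swap x y).injective this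
  · have h1 : χ (swap x y * σ * swap x y) = χ σ := by
      rw [map_mul, map_mul, mul_right_comm, ← map_mul, swap_mul_self, map_one, one_mul]
    have h2 : ρ (swap x y * σ * swap x y) * ρ (swap x y) = ρ (swap x y) * ρ σ := by
      rw [← map_mul, mul_assoc, swap_mul_self, mul_one, map_mul]
    simp only [MulEquiv.toEquiv_eq_coe, EquivLike.coe_coe, MulAut.conj_apply, swap_inv]
    rw [h1, smul_mul_assoc, h2, mul_smul_comm]

/-- Coset decomposition: σ factors uniquely as (x y) τ with τ fixing x, where y = σ x. The case y =
x gives the trivial coset. -/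
theorem sum_permsOn_insert {M : Type*} [AddCommMonoid M] (f : Perm ι → M) {T : Finset ι} {x : ι}
    (hx : x ∉ T) :
    ∑ σ ∈ permsOn (insert x T), f σ = ∑ y ∈ insert x T, ∑ τ ∈ permsOn T, f (swap x y * τ) := by
  rw [← sum_product']
  symm
  have hmem : x ∈ insert x T := mem_insert_self x T
  refine sum_bij' (fun p _ => swap x p.1 * p.2) (fun σ _ => (σ x, swap x (σ x) * σ)) ?_ ?_ ?_ ?_ ?_
  · rintro ⟨y, τ⟩ h
    rw [mem_product] at h
    exact (swap_mul_mem_permsOn_iff hmem h.1).2 (permsOn_mono (subset_insert x T) h.2)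
  · intro σ h
    have hσx := (apply_mem_iff_of_mem_permsOn h x).1 hmem
    refine mem_product.2 ⟨hσx, ?_⟩
    have h' := (swap_mul_mem_permsOn_iff hmem hσx).2 h
    rw [mem_permsOn] at h' ⊢
    intro i hi
    rcases eq_or_ne i x with rfl | hne
    · simp
    · exact h' i (by simp [hne, hi])
  · rintro ⟨y, τ⟩ h
    have hτ : τ x = x := mem_permsOn.1 (mem_product.1 h).2 x hx
    simp [hτ]
  · intro σ _
    simp
  · intro p _
    rfl

theorem symSum_insert {ε : ℂ} (hχ : ∀ x y : ι, x ≠ y → χ (swap x y) = ε)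
    {T : Finset ι} {x : ι} (hx : x ∉ T) :
    symSum ρ χ (insert x T) = symSum ρ χ T + ε • (jucysMurphy ρ x T * symSum ρ χ T) := by
  rw [symSum, sum_permsOn_insert _ hx, sum_insert hx, jucysMurphy, sum_mul, smul_sum]
  congr 1
  · simp only [symSum, swap_self, ← Perm.one_def, one_mul]
  · refine sum_congr rfl fun y hy => ?_
    have hxy : x ≠ y := fun h => hx (h ▸ hy)
    rw [symSum, mul_sum, smul_sum]
    refine sum_congr rfl fun τ _ => ?_
    simp [hχ x y hxy, smul_smul]

theorem commute_jucysMurphy_symSum {S T : Finset ι} (hTS : T ⊆ S) {x : ι} (hx : x ∉ S) :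
    Commute (jucysMurphy ρ x S) (symSum ρ χ T) :=
  Commute.sum_right _ _ _ fun _ hσ =>
    ((commute_jucysMurphy ρ hx (permsOn_mono hTS hσ)).symm).smul_right _

/-- The sum of the weighted symmetric sums over all subsets of `S`. -/
def subsetSum (w : ℕ → ℂ) (S : Finset ι) : R :=
  ∑ T ∈ S.powerset, w T.card • symSum ρ χ T

theorem subsetSum_empty {w : ℕ → ℂ} (hw : w 0 = 1) : subsetSum ρ χ w ∅ = 1 := by
  simp [subsetSum, symSum_empty, hw]

theorem commute_jucysMurphy_subsetSum (w : ℕ → ℂ) {S : Finset ι} {x : ι} (hx : x ∉ S) :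
    Commute (jucysMurphy ρ x S) (subsetSum ρ χ w S) :=
  Commute.sum_right _ _ _ fun _ hT =>
    (commute_jucysMurphy_symSum ρ χ (mem_powerset.1 hT) hx).smul_right _

/-- Both sides are sums of terms X_T (x y), where X_T is the symmetric sum of T and y ∈ T. On the
right, (x y) X_{T ∪ {x}} = X_{T ∪ {y}} (x y), so the pair (T, y) with y ∉ T there matches (T ∪ {y},
y) on the left. This is the cancellation behind `subsetSum_recursion`. -/
theorem sum_jucysMurphy_mul_symSum (w : ℕ → ℂ) {S : Finset ι} {x : ι} (hx : x ∉ S) :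
    ∑ T ∈ S.powerset, w T.card • (jucysMurphy ρ x T * symSum ρ χ T) =
      ∑ T ∈ S.powerset,
        w (T.card + 1) • (jucysMurphy ρ x (S \ T) * symSum ρ χ (insert x T)) := by
  have hL : ∀ T ∈ S.powerset, w T.card • (jucysMurphy ρ x T * symSum ρ χ T) =
      ∑ y ∈ T, w T.card • (symSum ρ χ T * ρ (swap x y)) := by
    intro T hT
    have hxT : x ∉ T := fun h => hx (mem_powerset.1 hT h)
    rw [(commute_jucysMurphy_symSum ρ χ (Subset.refl T) hxT).eq, jucysMurphy, mul_sum, smul_sum]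
  have hR : ∀ T ∈ S.powerset,
      w (T.card + 1) • (jucysMurphy ρ x (S \ T) * symSum ρ χ (insert x T)) =
      ∑ y ∈ S \ T, w (T.card + 1) • (symSum ρ χ (insert y T) * ρ (swap x y)) := by
    intro T hT
    have hxT : x ∉ T := fun h => hx (mem_powerset.1 hT h)
    rw [jucysMurphy, sum_mul, smul_sum]
    refine sum_congr rfl fun y hy => ?_
    rw [swap_mul_symSum_insert ρ χ hxT (mem_sdiff.1 hy).2]
  rw [sum_congr rfl hL, sum_congr rfl hR, sum_sigma', sum_sigma']
  refine sum_bij' (fun p _ => ⟨p.1.erase p.2, p.2⟩) (fun p _ => ⟨insert p.2 p.1, p.2⟩)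
    ?_ ?_ ?_ ?_ ?_
  · rintro ⟨T, y⟩ h
    simp only [mem_sigma, mem_powerset, mem_sdiff] at h ⊢
    exact ⟨(erase_subset _ _).trans h.1, h.1 h.2, notMem_erase _ _⟩
  · rintro ⟨T, y⟩ h
    simp only [mem_sigma, mem_powerset, mem_sdiff] at h ⊢
    exact ⟨insert_subset h.2.1 h.1, mem_insert_self _ _⟩
  · rintro ⟨T, y⟩ h
    simp only [mem_sigma] at h
    simp [insert_erase h.2]
  · rintro ⟨T, y⟩ h
    simp only [mem_sigma, mem_sdiff] at h
    simp [erase_insert h.2.2]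
  · rintro ⟨T, y⟩ h
    simp only [mem_sigma] at h
    simp only [insert_erase h.2, card_erase_add_one h.2]

theorem subsetSum_insert {w : ℕ → ℂ} {S : Finset ι} {x : ι} (hx : x ∉ S) :
    subsetSum ρ χ w (insert x S) = subsetSum ρ χ w S +
      ∑ T ∈ S.powerset, w (T.card + 1) • symSum ρ χ (insert x T) := by
  rw [subsetSum, sum_powerset_insert hx, subsetSum]
  congr 1
  refine sum_congr rfl fun T hT => ?_
  rw [card_insert_of_notMem fun h => hx (mem_powerset.1 hT h)]

theorem jucysMurphy_mul_symSum_insert {ε : ℂ} (hε : ε * ε = 1)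
    (hχ : ∀ x y : ι, x ≠ y → χ (swap x y) = ε) {T : Finset ι} {x : ι} (hx : x ∉ T) :
    jucysMurphy ρ x T * symSum ρ χ (insert x T) =
      (ε * T.card) • symSum ρ χ (insert x T) := by
  rw [jucysMurphy, sum_mul, sum_congr rfl fun y hy => swap_mul_symSum ρ χ hε hχ
    (mem_insert_self x T) (mem_insert_of_mem hy) (fun h => hx (h ▸ hy))]
  rw [sum_const, ← Nat.cast_smul_eq_nsmul ℂ, smul_smul, mul_comm]

/-- The recursion that characterizes the weighted sums: up to a shift of the parameter, adding a
point multiplies by a quotient of two linear factors in the Jucys–Murphy element. -/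
theorem subsetSum_recursion {ε : ℂ} (hε : ε * ε = 1)
    (hχ : ∀ x y : ι, x ≠ y → χ (swap x y) = ε) {w : ℕ → ℂ} {z : ℂ} {S : Finset ι} {x : ι}
    (hx : x ∉ S) (hw : ∀ t ≤ S.card, w t = (z - t) * w (t + 1)) :
    (z • 1 - ε • jucysMurphy ρ x S) * subsetSum ρ χ w (insert x S) =
      ((z + 1) • 1 - ε • jucysMurphy ρ x S) * subsetSum ρ χ w S := by
  have hstep : ∀ T ∈ S.powerset,
      (z • 1 - ε • jucysMurphy ρ x S) * (w (T.card + 1) • symSum ρ χ (insert x T)) =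
        w T.card • symSum ρ χ T + ε • (w T.card • (jucysMurphy ρ x T * symSum ρ χ T)) -
        ε • (w (T.card + 1) • (jucysMurphy ρ x (S \ T) * symSum ρ χ (insert x T))) := by
    intro T hT
    have hTS := mem_powerset.1 hT
    have hxT : x ∉ T := fun h => hx (hTS h)
    -- On the symmetric sum of T ∪ {x}, ε times the part of J from T acts as the scalar |T|. Thus z
    -- minus it acts as z - |T|, which `hw` absorbs into the weight.
    have hJ : jucysMurphy ρ x S = jucysMurphy ρ x (S \ T) + jucysMurphy ρ x T :=
      (sum_sdiff hTS).symm
    have h1 := jucysMurphy_mul_symSum_insert ρ χ hε hχ hxT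
    have h2 : w T.card • symSum ρ χ T + ε • (w T.card • (jucysMurphy ρ x T * symSum ρ χ T)) =
        w T.card • symSum ρ χ (insert x T) := by
      rw [symSum_insert ρ χ hχ hxT, smul_add, smul_comm ε]
    rw [h2, hJ, hw _ (card_le_card hTS)]
    simp only [sub_mul, add_mul, smul_add, smul_mul_assoc, mul_smul_comm, one_mul, h1]
    match_scalars
    all_goals first | ring1 | linear_combination (-(w (T.card + 1) * (T.card : ℂ))) * hε
  -- After summation over T the two terms with factor ε cancel by the exchange identity. Only the
  -- subset sum of S survives, which raises z to z + 1.
  rw [subsetSum_insert ρ χ hx, mul_add, mul_sum, sum_congr rfl hstep, sum_sub_distrib,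
    sum_add_distrib, ← smul_sum, ← smul_sum, sum_jucysMurphy_mul_symSum ρ χ w hx,
    add_sub_cancel_right, add_smul, one_smul, ← subsetSum]
  noncomm_ring

end SymmetricSums

/-! ### Invariance of Haar measure and polarization of moments -/

section UnitaryMoments

variable {n : ℕ}

/-- The right translate of Haar measure is again a Haar probability measure, so uniqueness makes it
equal to the original. -/
theorem integral_unitaryHaar_mul_right (f : Matrix.unitaryGroup (Fin n) ℂ → ℂ)
    (V : Matrix.unitaryGroup (Fin n) ℂ) :
    ∫ U, f (U * V) ∂(unitaryHaar n) = ∫ U, f U ∂(unitaryHaar n) := by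
  have hprob : IsProbabilityMeasure ((unitaryHaar n).map (· * V)) :=
    Measure.isProbabilityMeasure_map (by fun_prop)
  have hmap : (unitaryHaar n).map (· * V) = unitaryHaar n :=
    Measure.isHaarMeasure_eq_of_isProbabilityMeasure _ _
  have h := (Homeomorph.mulRight V).isClosedEmbedding.measurableEmbedding.integral_map
    (μ := unitaryHaar n) f
  simp only [Homeomorph.coe_mulRight] at h
  rw [← h, hmap]

theorem integrable_unitaryHaar {f : Matrix.unitaryGroup (Fin n) ℂ → ℂ} (hf : Continuous f) :
    Integrable f (unitaryHaar n) :=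
  hf.integrable_of_hasCompactSupport (HasCompactSupport.of_compactSpace f)

theorem continuous_entry (i j : Fin n) :
    Continuous fun U : Matrix.unitaryGroup (Fin n) ℂ => (U : Matrix (Fin n) (Fin n) ℂ) i j :=
  continuous_subtype_val.matrix_elem i j

/-- The permutation matrix whose right multiplication permutes the columns by `σ`. -/
def columnPerm (σ : Perm (Fin n)) : Matrix.unitaryGroup (Fin n) ℂ :=
  ⟨(1 : Matrix (Fin n) (Fin n) ℂ).submatrix id σ, by
    rw [Matrix.mem_unitaryGroup_iff', Matrix.star_eq_conjTranspose, Matrix.conjTranspose_submatrix,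
      Matrix.conjTranspose_one]
    ext i j
    simp [Matrix.mul_apply, Matrix.one_apply]⟩

theorem mul_columnPerm_apply (U : Matrix.unitaryGroup (Fin n) ℂ) (σ : Perm (Fin n)) (i j : Fin n) :
    ((U * columnPerm σ : Matrix.unitaryGroup (Fin n) ℂ) : Matrix (Fin n) (Fin n) ℂ) i j =
      (U : Matrix (Fin n) (Fin n) ℂ) i (σ j) := by
  simp [columnPerm, Matrix.mul_apply, Matrix.one_apply]

/-- The diagonal matrix with entry `I` at `p` and `1` elsewhere. -/
def phaseAt (p : Fin n) : Matrix.unitaryGroup (Fin n) ℂ :=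
  ⟨Matrix.diagonal fun j => if j = p then Complex.I else 1, by
    rw [Matrix.mem_unitaryGroup_iff', Matrix.star_eq_conjTranspose, Matrix.diagonal_conjTranspose,
      Matrix.diagonal_mul_diagonal, ← Matrix.diagonal_one]
    congr 1
    ext j
    by_cases h : j = p <;> simp [h]⟩

theorem mul_phaseAt_apply (U : Matrix.unitaryGroup (Fin n) ℂ) (p i j : Fin n) :
    ((U * phaseAt p : Matrix.unitaryGroup (Fin n) ℂ) : Matrix (Fin n) (Fin n) ℂ) i j =
      (U : Matrix (Fin n) (Fin n) ℂ) i j * if j = p then Complex.I else 1 := by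
  simp [phaseAt]

/-- The vector `e_p - 2 e_q`. -/
def mirror (p q : Fin n) : Fin n → ℂ := fun j => if j = p then 1 else if j = q then -2 else 0

theorem sum_mul_mirror {p q : Fin n} (hpq : p ≠ q) (f : Fin n → ℂ) :
    ∑ j, f j * mirror p q j = f p - 2 * f q := by
  have h : ∀ j, f j * mirror p q j =
      (if j = p then f j else 0) + (if j = q then -2 * f j else 0) := by
    intro j
    unfold mirror
    rcases eq_or_ne j p with rfl | h1
    · simp [hpq]
    · simp [h1, mul_comm]
  rw [sum_congr rfl fun j _ => h j, sum_add_distrib]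
  simp
  ring

/-- The reflection through the hyperplane orthogonal to `e_p - 2 e_q`. -/
noncomputable def reflection {p q : Fin n} (hpq : p ≠ q) : Matrix.unitaryGroup (Fin n) ℂ :=
  ⟨Matrix.of fun i j => (if i = j then 1 else 0) - 2 / 5 * mirror p q i * mirror p q j, by
    rw [Matrix.mem_unitaryGroup_iff']
    have hstar : ∀ i, star (mirror p q i) = mirror p q i := by
      intro i
      unfold mirror
      split_ifs <;> simp
    have hs : star (Matrix.of fun i j =>
        (if i = j then (1 : ℂ) else 0) - 2 / 5 * mirror p q i * mirror p q j) =
        Matrix.of fun i j => (if i = j then 1 else 0) - 2 / 5 * mirror p q i * mirror p q j := by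
      ext i j
      simp only [Matrix.star_apply, Matrix.of_apply, star_sub, star_mul', hstar]
      have : star (2 / 5 : ℂ) = 2 / 5 := by simp
      rw [this, apply_ite star, star_one, star_zero]
      simp only [eq_comm]
      ring
    rw [hs]
    ext i j
    have hsq : ∑ l, mirror p q l * mirror p q l = 5 := by
      rw [sum_mul_mirror hpq]
      simp [mirror, hpq.symm]
      norm_num
    have hexp : ∀ l, ((if i = l then (1 : ℂ) else 0) - 2 / 5 * mirror p q i * mirror p q l) *
        ((if l = j then 1 else 0) - 2 / 5 * mirror p q l * mirror p q j) =
        (if i = l then (if l = j then 1 else 0) else 0)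
          - (if i = l then 2 / 5 * mirror p q l * mirror p q j else 0)
          - (if l = j then 2 / 5 * mirror p q i * mirror p q l else 0)
          + 4 / 25 * mirror p q i * mirror p q j * (mirror p q l * mirror p q l) := by
      intro l
      split_ifs <;> ring
    simp only [Matrix.mul_apply, Matrix.of_apply]
    rw [sum_congr rfl fun l _ => hexp l, sum_add_distrib, sum_sub_distrib, sum_sub_distrib,
      ← mul_sum, hsq]
    simp [Matrix.one_apply]
    ring⟩

theorem mul_reflection_apply {p q : Fin n} (hpq : p ≠ q) (U : Matrix.unitaryGroup (Fin n) ℂ)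
    (i j : Fin n) :
    ((U * reflection hpq : Matrix.unitaryGroup (Fin n) ℂ) : Matrix (Fin n) (Fin n) ℂ) i j =
      (U : Matrix (Fin n) (Fin n) ℂ) i j - 2 / 5 * mirror p q j *
        ((U : Matrix (Fin n) (Fin n) ℂ) i p - 2 * (U : Matrix (Fin n) (Fin n) ℂ) i q) := by
  rw [← sum_mul_mirror hpq, mul_sum]
  simp only [reflection, Submonoid.coe_mul, Matrix.mul_apply, Matrix.of_apply, mul_sub,
    sum_sub_distrib, mul_ite, mul_one, mul_zero]
  simp
  exact sum_congr rfl fun l _ => by ring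

/-- Polarization in two columns: a fourth-order moment with a repeated column is the sum of the
two moments in which the repetition is resolved. -/
theorem integral_repeated_column {p q : Fin n} (hpq : p ≠ q)
    {X : Matrix.unitaryGroup (Fin n) ℂ → ℂ} (hX : Continuous X)
    (hXcol : ∀ U U' : Matrix.unitaryGroup (Fin n) ℂ,
      (∀ i j, j ≠ p → j ≠ q → (U : Matrix (Fin n) (Fin n) ℂ) i j =
        (U' : Matrix (Fin n) (Fin n) ℂ) i j) → X U = X U')
    (r₁ r₂ s₁ s₂ : Fin n) {E : Fin n → Fin n → Fin n → Fin n → ℂ}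
    (hE : ∀ a b c d, E a b c d = ∫ U : Matrix.unitaryGroup (Fin n) ℂ,
      X U * ((U : Matrix (Fin n) (Fin n) ℂ) r₁ a * (U : Matrix (Fin n) (Fin n) ℂ) r₂ b *
        star ((U : Matrix (Fin n) (Fin n) ℂ) s₁ c) * star ((U : Matrix (Fin n) (Fin n) ℂ) s₂ d))
      ∂(unitaryHaar n)) :
    E p p p p = E p q p q + E p q q p := by
  have hqp := hpq.symm
  -- The phase multiplies a moment by I to the power (number of p among a, b) minus (number of p
  -- among c, d). The phase -1 would not detect a difference of two, as in `E p p q q`.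
  have hphase : ∀ a b c d, E a b c d =
      (if a = p then Complex.I else 1) * (if b = p then Complex.I else 1) *
        star (if c = p then Complex.I else 1) * star (if d = p then Complex.I else 1) *
        E a b c d := by
    intro a b c d
    conv_lhs => rw [hE, ← integral_unitaryHaar_mul_right _ (phaseAt p)]
    rw [hE, ← integral_const_mul]
    congr 1
    ext U
    rw [hXcol (U * phaseAt p) U fun i j h1 _ => by simp [mul_phaseAt_apply, h1]]
    simp only [mul_phaseAt_apply, star_mul']
    ring
  have hswap : ∀ a b c d, E a b c d = E (swap p q a) (swap p q b) (swap p q c) (swap p q d) := by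
    intro a b c d
    rw [hE, hE, ← integral_unitaryHaar_mul_right _ (columnPerm (swap p q))]
    congr 1
    ext U
    rw [hXcol (U * columnPerm (swap p q)) U fun i j h1 h2 => by
      rw [mul_columnPerm_apply, swap_apply_of_ne_of_ne h1 h2]]
    simp only [mul_columnPerm_apply]
  -- The reflection replaces column p by 3/5 of column p plus 4/5 of column q; the rational
  -- coefficients come from the squared norm 5 of e_p - 2 e_q.
  have hexpand : E p p p p = ∑ t : Fin 2 × Fin 2 × Fin 2 × Fin 2,
      ((![3 / 5, 4 / 5] : Fin 2 → ℂ) t.1 * (![3 / 5, 4 / 5] : Fin 2 → ℂ) t.2.1 *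
        (![3 / 5, 4 / 5] : Fin 2 → ℂ) t.2.2.1 * (![3 / 5, 4 / 5] : Fin 2 → ℂ) t.2.2.2) *
        E (![p, q] t.1) (![p, q] t.2.1) (![p, q] t.2.2.1) (![p, q] t.2.2.2) := by
    simp only [hE, ← integral_const_mul]
    rw [← integral_finsetSum, ← integral_unitaryHaar_mul_right _ (reflection hpq)]
    · congr 1
      ext U
      rw [hXcol (U * reflection hpq) U fun i j h1 h2 => by
        simp [mul_reflection_apply, mirror, h1, h2]]
      have hp : ∀ i, ((U * reflection hpq : Matrix.unitaryGroup (Fin n) ℂ) :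
          Matrix (Fin n) (Fin n) ℂ) i p = 3 / 5 * (U : Matrix (Fin n) (Fin n) ℂ) i p +
            4 / 5 * (U : Matrix (Fin n) (Fin n) ℂ) i q := by
        intro i
        rw [mul_reflection_apply]
        simp only [mirror, if_true]
        ring
      have h3 : star (3 / 5 : ℂ) = 3 / 5 := by simp
      have h4 : star (4 / 5 : ℂ) = 4 / 5 := by simp
      simp only [hp, star_add, star_mul', h3, h4, Fintype.sum_prod_type, Fin.sum_univ_two,
        Matrix.cons_val_zero, Matrix.cons_val_one]
      ring
    · intro t _
      refine integrable_unitaryHaar (continuous_const.mul (hX.mul ?_))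
      exact (((continuous_entry _ _).mul (continuous_entry _ _)).mul
        (continuous_entry _ _).star).mul (continuous_entry _ _).star
  have hzero : ∀ {z c : ℂ}, z = c * z → c ≠ 1 → z = 0 := by
    intro z c h hc
    have : (1 - c) * z = 0 := by linear_combination h
    exact (mul_eq_zero.1 this).resolve_left (sub_ne_zero.2 hc.symm)
  have hI1 : Complex.I ≠ 1 := fun h => by simpa using congrArg Complex.re h
  have hI2 : -Complex.I ≠ 1 := fun h => by simpa using congrArg Complex.re h
  have hI3 : (-1 : ℂ) ≠ 1 := by norm_num
  simp only [Fintype.sum_prod_type, Fin.sum_univ_two, Matrix.cons_val_zero,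
    Matrix.cons_val_one] at hexpand
  have z1 : E p p p q = 0 := hzero (hphase _ _ _ _) (by simpa [hqp] using hI1)
  have z2 : E p p q p = 0 := hzero (hphase _ _ _ _) (by simpa [hqp] using hI1)
  have z3 : E p q p p = 0 := hzero (hphase _ _ _ _) (by simpa [hqp] using hI2)
  have z4 : E q p p p = 0 := hzero (hphase _ _ _ _) (by simpa [hqp] using hI2)
  have z5 : E p p q q = 0 := hzero (hphase _ _ _ _) (by simpa [hqp] using hI3)
  have z6 : E q q p p = 0 := hzero (hphase _ _ _ _) (by simpa [hqp] using hI3)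
  have z7 : E q q q p = 0 := hzero (hphase _ _ _ _) (by simpa [hqp] using hI2)
  have z8 : E q q p q = 0 := hzero (hphase _ _ _ _) (by simpa [hqp] using hI2)
  have z9 : E q p q q = 0 := hzero (hphase _ _ _ _) (by simpa [hqp] using hI1)
  have z10 : E p q q q = 0 := hzero (hphase _ _ _ _) (by simpa [hqp] using hI1)
  have s1 : E q q q q = E p p p p := by rw [hswap]; simp
  have s2 : E q p q p = E p q p q := by rw [hswap]; simp
  have s3 : E q p p q = E p q q p := by rw [hswap]; simp
  rw [z1, z2, z3, z4, z5, z6, z7, z8, z9, z10, s1, s2, s3] at hexpand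
  -- What remains is E_pppp = (81 + 256)/625 · E_pppp + 2 · 144/625 · (E_pqpq + E_pqqp), and 1 -
  -- 337/625 = 288/625.
  linear_combination (625 / 288 : ℂ) * hexpand

end UnitaryMoments

/-! ### The orthogonality recursion for Weingarten moments -/

section WeingartenRecursion

variable {ι : Type*} {n : ℕ}

theorem continuous_prod_entry (S : Finset ι) (a b : ι → Fin n) :
    Continuous fun U : Matrix.unitaryGroup (Fin n) ℂ =>
      ∏ i ∈ S, (U : Matrix (Fin n) (Fin n) ℂ) (a i) (b i) :=
  continuous_finsetProd _ fun _ _ => continuous_entry _ _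

variable [Fintype ι] [DecidableEq ι]

/-- The moment `𝔼[∏ u_{ii} conj (∏ u_{iπ(i)})]` over `i ∈ S`, for `π` a permutation of `S`, where
the index set is embedded in `{1, …, n}` by `r`. It vanishes for the other permutations. -/
noncomputable def weingartenOn (r : ι → Fin n) (S : Finset ι) (π : Perm ι) : ℂ :=
  if π ∈ permsOn S then
    ∫ U : Matrix.unitaryGroup (Fin n) ℂ,
      (∏ i ∈ S, (U : Matrix (Fin n) (Fin n) ℂ) (r i) (r i)) *
        star (∏ i ∈ S, (U : Matrix (Fin n) (Fin n) ℂ) (r i) (r (π i))) ∂(unitaryHaar n)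
  else 0

theorem weingartenOn_empty (r : ι → Fin n) (π : Perm ι) :
    weingartenOn r ∅ π = if π = 1 then 1 else 0 := by
  simp [weingartenOn, permsOn_empty]

theorem sum_entry_mul_star (U : Matrix.unitaryGroup (Fin n) ℂ) (a b : Fin n) :
    ∑ j, (U : Matrix (Fin n) (Fin n) ℂ) a j * star ((U : Matrix (Fin n) (Fin n) ℂ) b j) =
      if a = b then 1 else 0 := by
  have h := congrFun (congrFun (Matrix.mem_unitaryGroup_iff.1 U.2) a) b
  simpa [Matrix.mul_apply, Matrix.one_apply] using h

/-- The orthogonality recursion for the Weingarten function. -/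
theorem weingartenOn_recursion {r : ι → Fin n} (hr : Function.Injective r) {S : Finset ι} {x : ι}
    (hx : x ∉ S) (π : Perm ι) :
    (n : ℂ) * weingartenOn r (insert x S) π +
      ∑ y ∈ S, weingartenOn r (insert x S) (swap x y * π) = weingartenOn r S π := by
  set Q := insert x S with hQ
  have hxQ : x ∈ Q := mem_insert_self x S
  have hSQ : S ⊆ Q := subset_insert x S
  have hsw : ∀ y ∈ S, (swap x y * π ∈ permsOn Q ↔ π ∈ permsOn Q) := fun y hy =>
    swap_mul_mem_permsOn_iff hxQ (hSQ hy)
  by_cases hπ : π ∈ permsOn Q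
  swap
  · have h1 : ∀ y ∈ S, weingartenOn r Q (swap x y * π) = 0 := fun y hy =>
      if_neg fun h => hπ ((hsw y hy).1 h)
    rw [sum_eq_zero h1, weingartenOn, if_neg hπ, weingartenOn,
      if_neg fun h => hπ (permsOn_mono hSQ h)]
    simp
  obtain ⟨i₀, hi₀⟩ := π.surjective x
  have hi₀Q : i₀ ∈ Q := (apply_mem_iff_of_mem_permsOn hπ i₀).2 (hi₀ ▸ hxQ)
  have hrest : ∀ i ∈ Q.erase i₀, π i ∈ S := fun i hi => by
    have h1 := (apply_mem_iff_of_mem_permsOn hπ i).1 (mem_of_mem_erase hi)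
    refine (mem_insert.1 h1).resolve_left fun h => ?_
    exact ne_of_mem_erase hi (π.injective (h.trans hi₀.symm))
  -- This is the Weingarten integrand with column x replaced by j in the two factors that use it,
  -- namely row x and, among the conjugates, row i₀ = π⁻¹(x). Summing over j is then row
  -- orthogonality.
  let g : Fin n → Matrix.unitaryGroup (Fin n) ℂ → ℂ := fun j U =>
    (∏ i ∈ S, (U : Matrix (Fin n) (Fin n) ℂ) (r i) (r i)) *
      star (∏ i ∈ Q.erase i₀, (U : Matrix (Fin n) (Fin n) ℂ) (r i) (r (π i))) *
      ((U : Matrix (Fin n) (Fin n) ℂ) (r x) j * star ((U : Matrix (Fin n) (Fin n) ℂ) (r i₀) j))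
  have hgcont : ∀ j, Continuous (g j) := fun j =>
    ((continuous_prod_entry _ _ _).mul (continuous_prod_entry _ _ _).star).mul
      ((continuous_entry _ _).mul (continuous_entry _ _).star)
  have hsum : ∑ j, ∫ U, g j U ∂(unitaryHaar n) = weingartenOn r S π := by
    rw [← integral_finsetSum _ fun j _ => integrable_unitaryHaar (hgcont j)]
    simp only [g, ← mul_sum, sum_entry_mul_star]
    -- The inner product of rows x and i₀ vanishes unless π fixes x, which is exactly when π is a
    -- permutation of S.
    by_cases h : i₀ = x
    · subst h
      have hπS : π ∈ permsOn S := by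
        rw [mem_permsOn] at hπ ⊢
        intro i hi
        rcases eq_or_ne i i₀ with rfl | hne
        · exact hi₀
        · exact hπ i (by simp [hQ, hne, hi])
      rw [weingartenOn, if_pos hπS, hQ, erase_insert hx]
      simp
    · have hπS : π ∉ permsOn S := fun hm => h (π.injective (hi₀.trans (mem_permsOn.1 hm x hx).symm))
      rw [weingartenOn, if_neg hπS]
      simp [hr.ne (Ne.symm h)]
  have hdiag : ∫ U, g (r x) U ∂(unitaryHaar n) = weingartenOn r Q π := by
    rw [weingartenOn, if_pos hπ]
    congr 1
    ext U
    simp only [g]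
    rw [hQ, prod_insert hx, ← hQ, ← mul_prod_erase Q _ hi₀Q, hi₀, star_mul']
    ring
  have hfar : ∀ j ∉ S.image r, ∫ U, g j U ∂(unitaryHaar n) = weingartenOn r Q π := by
    intro j hj
    have hjS : ∀ i ∈ S, r i ≠ j := fun i hi h => hj (mem_image.2 ⟨i, hi, h⟩)
    have hxS : ∀ i ∈ S, r i ≠ r x := fun i hi h => hx (hr h ▸ hi)
    -- The other factors use neither column j nor column x, so exchanging these columns changes only
    -- the two distinguished factors.
    rw [← hdiag, ← integral_unitaryHaar_mul_right _ (columnPerm (swap (r x) j))]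
    congr 1
    ext U
    simp only [g, mul_columnPerm_apply, swap_apply_right]
    congr 2
    · refine prod_congr rfl fun i hi => ?_
      rw [swap_apply_of_ne_of_ne (hxS i hi) (hjS i hi)]
    · congr 1
      refine prod_congr rfl fun i hi => ?_
      rw [swap_apply_of_ne_of_ne (hxS _ (hrest i hi)) (hjS _ (hrest i hi))]
  have hnear : ∀ y ∈ S, ∫ U, g (r y) U ∂(unitaryHaar n) =
      weingartenOn r Q π + weingartenOn r Q (swap x y * π) := by
    intro y hy
    have hxy : x ≠ y := fun h => hx (h ▸ hy)
    obtain ⟨i₁, hi₁⟩ := π.surjective y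
    have hi₁Q : i₁ ∈ Q := (apply_mem_iff_of_mem_permsOn hπ i₁).2 (hi₁ ▸ hSQ hy)
    have hne : i₁ ≠ i₀ := fun h => hxy (by rw [← hi₀, ← hi₁, h])
    have hi₁E : i₁ ∈ Q.erase i₀ := mem_erase.2 ⟨hne, hi₁Q⟩
    have hrest' : ∀ i ∈ (Q.erase i₀).erase i₁, π i ∈ S ∧ π i ≠ y := fun i hi =>
      ⟨hrest i (mem_of_mem_erase hi), fun h =>
        ne_of_mem_erase hi (π.injective (h.trans hi₁.symm))⟩
    let X : Matrix.unitaryGroup (Fin n) ℂ → ℂ := fun U =>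
      (∏ i ∈ S.erase y, (U : Matrix (Fin n) (Fin n) ℂ) (r i) (r i)) *
        star (∏ i ∈ (Q.erase i₀).erase i₁, (U : Matrix (Fin n) (Fin n) ℂ) (r i) (r (π i)))
    have hXcont : Continuous X :=
      (continuous_prod_entry _ _ _).mul (continuous_prod_entry _ _ _).star
    have hXcol : ∀ U U' : Matrix.unitaryGroup (Fin n) ℂ,
        (∀ i j, j ≠ r y → j ≠ r x → (U : Matrix (Fin n) (Fin n) ℂ) i j =
          (U' : Matrix (Fin n) (Fin n) ℂ) i j) → X U = X U' := by
      intro U U' h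
      simp only [X]
      congr 1
      · refine prod_congr rfl fun i hi => h _ _ (hr.ne (ne_of_mem_erase hi)) (hr.ne ?_)
        exact fun hix => hx (hix ▸ mem_of_mem_erase hi)
      · congr 1
        refine prod_congr rfl fun i hi => h _ _ (hr.ne (hrest' i hi).2) (hr.ne ?_)
        exact fun hix => hx (hix ▸ (hrest' i hi).1)
    -- Column y now occurs in rows y, x and, conjugated, in rows i₁, i₀. Resolving the repetition
    -- leaves i₁ ↦ y, i₀ ↦ x, which is π, or the exchanged assignment, which is (x y) π.
    have hmain := integral_repeated_column (hr.ne hxy.symm) hXcont hXcol (r y) (r x) (r i₁) (r i₀)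
      (fun _ _ _ _ => rfl)
    have hw : weingartenOn r Q π = ∫ U : Matrix.unitaryGroup (Fin n) ℂ,
        X U * ((U : Matrix (Fin n) (Fin n) ℂ) (r y) (r y) *
          (U : Matrix (Fin n) (Fin n) ℂ) (r x) (r x) *
          star ((U : Matrix (Fin n) (Fin n) ℂ) (r i₁) (r y)) *
          star ((U : Matrix (Fin n) (Fin n) ℂ) (r i₀) (r x))) ∂(unitaryHaar n) := by
      rw [weingartenOn, if_pos hπ]
      congr 1
      ext U
      simp only [X]
      rw [hQ, prod_insert hx, ← hQ, ← mul_prod_erase S _ hy, ← mul_prod_erase Q _ hi₀Q,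
        ← mul_prod_erase (Q.erase i₀) _ hi₁E, hi₀, hi₁, star_mul', star_mul']
      ring
    have hw' : weingartenOn r Q (swap x y * π) = ∫ U : Matrix.unitaryGroup (Fin n) ℂ,
        X U * ((U : Matrix (Fin n) (Fin n) ℂ) (r y) (r y) *
          (U : Matrix (Fin n) (Fin n) ℂ) (r x) (r x) *
          star ((U : Matrix (Fin n) (Fin n) ℂ) (r i₁) (r x)) *
          star ((U : Matrix (Fin n) (Fin n) ℂ) (r i₀) (r y))) ∂(unitaryHaar n) := by
      rw [weingartenOn, if_pos ((hsw y hy).2 hπ)]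
      congr 1
      ext U
      have hprod : ∏ i ∈ (Q.erase i₀).erase i₁,
          (U : Matrix (Fin n) (Fin n) ℂ) (r i) (r ((swap x y * π) i)) =
          ∏ i ∈ (Q.erase i₀).erase i₁, (U : Matrix (Fin n) (Fin n) ℂ) (r i) (r (π i)) := by
        refine prod_congr rfl fun i hi => ?_
        have hix : π i ≠ x := fun h => hx (by rw [← h]; exact (hrest' i hi).1)
        rw [Perm.mul_apply, swap_apply_of_ne_of_ne hix (hrest' i hi).2]
      simp only [X]
      rw [hQ, prod_insert hx, ← hQ, ← mul_prod_erase S _ hy, ← mul_prod_erase Q _ hi₀Q,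
        ← mul_prod_erase (Q.erase i₀) _ hi₁E, hprod, Perm.mul_apply, Perm.mul_apply, hi₀, hi₁,
        swap_apply_left, swap_apply_right, star_mul', star_mul']
      ring
    rw [hw, hw', ← hmain]
    congr 1
    ext U
    simp only [X, g]
    rw [← mul_prod_erase S _ hy, ← mul_prod_erase (Q.erase i₀) _ hi₁E, hi₁, star_mul']
    ring
  have hle : S.card ≤ n := by
    simpa [card_image_of_injective S hr] using card_le_univ (S.image r)
  -- Each of the n columns contributes one value at π, and each column from S contributes one
  -- further value at (x y) π.
  rw [← hsum, ← sum_add_sum_compl (S.image r), sum_image fun a _ b _ h => hr h,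
    sum_congr rfl hnear, sum_congr rfl fun j hj => hfar j (mem_compl.1 hj), sum_add_distrib,
    sum_const, sum_const, card_compl, card_image_of_injective S hr, Fintype.card_fin]
  simp only [nsmul_eq_mul, Nat.cast_sub hle]
  ring

end WeingartenRecursion

/-! ### Transfer to the group algebra and invertibility -/

section GroupAlgebra

variable {ι : Type*} [Fintype ι] [DecidableEq ι]

/-- The element of the group algebra with given coefficients. -/
noncomputable def toGroupAlgebra (f : Perm ι → ℂ) : MonoidAlgebra ℂ (Perm ι) :=
  ∑ σ, f σ • MonoidAlgebra.of ℂ (Perm ι) σ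

theorem coeff_toGroupAlgebra (f : Perm ι → ℂ) (π : Perm ι) : (toGroupAlgebra f).coeff π = f π := by
  simp [toGroupAlgebra, MonoidAlgebra.coeff_sum, Finsupp.single_apply]

theorem toGroupAlgebra_injective :
    Function.Injective (toGroupAlgebra : (Perm ι → ℂ) → MonoidAlgebra ℂ (Perm ι)) := fun f g h => by
  ext π
  rw [← coeff_toGroupAlgebra f, h, coeff_toGroupAlgebra]

theorem toGroupAlgebra_conv {k : ℕ} (f g : Perm (Fin k) → ℂ) :
    toGroupAlgebra (conv f g) = toGroupAlgebra f * toGroupAlgebra g := by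
  simp only [toGroupAlgebra, conv, sum_mul_sum, sum_smul]
  rw [sum_comm]
  refine sum_congr rfl fun σ _ => ?_
  rw [← Equiv.sum_comp (Equiv.mulLeft σ)]
  refine sum_congr rfl fun τ _ => ?_
  rw [Equiv.coe_mulLeft, inv_mul_cancel_left, smul_mul_smul_comm, ← map_mul]

theorem toGroupAlgebra_diracId (k : ℕ) : toGroupAlgebra (diracId k) = 1 := by
  simp [toGroupAlgebra, diracId, MonoidAlgebra.one_def]

/-- The Jucys–Murphy recursion for the Weingarten elements. -/
theorem toGroupAlgebra_weingartenOn_recursion {n : ℕ} {r : ι → Fin n}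
    (hr : Function.Injective r) {S : Finset ι} {x : ι} (hx : x ∉ S) :
    ((n : ℂ) • 1 + jucysMurphy (MonoidAlgebra.of ℂ (Perm ι)) x S) *
      toGroupAlgebra (weingartenOn r (insert x S)) = toGroupAlgebra (weingartenOn r S) := by
  have hy : ∀ y, MonoidAlgebra.of ℂ (Perm ι) (swap x y) *
      toGroupAlgebra (weingartenOn r (insert x S)) =
      toGroupAlgebra fun π => weingartenOn r (insert x S) (swap x y * π) := by
    intro y
    simp only [toGroupAlgebra, mul_sum]
    rw [← Equiv.sum_comp (Equiv.mulLeft (swap x y))]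
    refine sum_congr rfl fun π _ => ?_
    rw [Equiv.coe_mulLeft, mul_smul_comm, ← map_mul, ← mul_assoc, swap_mul_self, one_mul]
  rw [add_mul, jucysMurphy, sum_mul, sum_congr rfl fun y _ => hy y]
  apply MonoidAlgebra.coeff_injective
  ext π
  simp only [smul_mul_assoc, one_mul, MonoidAlgebra.coeff_add, MonoidAlgebra.coeff_smul,
    MonoidAlgebra.coeff_sum, Finsupp.add_apply, Finsupp.smul_apply, Finsupp.finsetSum_apply,
    coeff_toGroupAlgebra, smul_eq_mul]
  exact weingartenOn_recursion hr hx π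

theorem toGroupAlgebra_weingartenOn_empty {n : ℕ} (r : ι → Fin n) :
    toGroupAlgebra (weingartenOn r ∅) = 1 := by
  simp [toGroupAlgebra, weingartenOn_empty, MonoidAlgebra.one_def]

/-- The recursion makes the element for the larger set a right factor of the one for S. In this
group algebra factors of a unit are units, so invertibility propagates from the empty set. -/
theorem isUnit_toGroupAlgebra_weingartenOn {n : ℕ} {r : ι → Fin n}
    (hr : Function.Injective r) (S : Finset ι) :
    IsUnit (toGroupAlgebra (weingartenOn r S)) := by
  induction S using Finset.induction_on with
  | empty => simp [toGroupAlgebra_weingartenOn_empty]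
  | insert x S hx ih =>
    rw [← toGroupAlgebra_weingartenOn_recursion hr hx] at ih
    exact isUnit_of_mul_isUnit_right ih

/-- Being the left factor in the recursion for an invertible Weingarten element, n + J is invertible
without any knowledge of its spectrum. -/
theorem isUnit_add_jucysMurphy {n : ℕ} {r : ι → Fin n} (hr : Function.Injective r)
    {S : Finset ι} {x : ι} (hx : x ∉ S) :
    IsUnit ((n : ℂ) • 1 + jucysMurphy (MonoidAlgebra.of ℂ (Perm ι)) x S) := by
  have h := isUnit_toGroupAlgebra_weingartenOn hr S
  rw [← toGroupAlgebra_weingartenOn_recursion hr hx] at h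
  exact isUnit_of_mul_isUnit_left h

/-! ### Ascension and descension as subset sums, and their recursions -/

theorem toGroupAlgebra_of_fixCount {k : ℕ} (χ : Perm (Fin k) →* ℂ) (w : ℕ → ℂ) :
    toGroupAlgebra (fun σ => χ σ * ∑ t ∈ range (fixCount σ + 1),
      ((fixCount σ).choose t : ℂ) * w (k - t)) =
      subsetSum (MonoidAlgebra.of ℂ (Perm (Fin k))) χ w univ := by
  have h : ∀ σ : Perm (Fin k), ∑ t ∈ range (fixCount σ + 1),
      ((fixCount σ).choose t : ℂ) * w (k - t) =
      ∑ T ∈ (univ : Finset (Fin k)).powerset, if σ ∈ permsOn T then w T.card else 0 := by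
    intro σ
    have h1 := sum_powerset_apply_card (fun t => w (k - t))
      (x := univ.filter fun i : Fin k => σ i = i)
    simp only [nsmul_eq_mul] at h1
    rw [fixCount, ← h1, ← sum_filter]
    -- A set of t fixed points of σ is the complement of a set of size k - t outside which σ is the
    -- identity.
    refine sum_bij' (fun T _ => Tᶜ) (fun T _ => Tᶜ) ?_ ?_ ?_ ?_ ?_
    · intro T hT
      simp only [mem_powerset, subset_iff, mem_filter, mem_univ, true_and] at hT
      simp only [mem_filter, mem_powerset, subset_univ, true_and, mem_permsOn, mem_compl, not_not]
      exact fun i hi => hT hi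
    · intro T hT
      simp only [mem_filter, mem_permsOn] at hT
      simp only [mem_powerset, subset_iff, mem_filter, mem_univ, true_and, mem_compl]
      exact fun i hi => hT.2 i hi
    · simp
    · simp
    · intro T _
      rw [card_compl, Fintype.card_fin]
  simp only [toGroupAlgebra, subsetSum, symSum, h, smul_sum, mul_sum, sum_smul]
  rw [sum_comm]
  refine sum_congr rfl fun T _ => ?_
  rw [← sum_subset (subset_univ (permsOn T))]
  · refine sum_congr rfl fun σ hσ => ?_
    rw [if_pos hσ, smul_smul, mul_comm]
  · intro σ _ hσ
    simp [hσ]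

/-- The sign of a permutation as a complex number. -/
noncomputable def complexSign (ι : Type*) [Fintype ι] [DecidableEq ι] : Perm ι →* ℂ :=
  ((Int.castRingHom ℂ : ℤ →* ℂ).comp (Units.coeHom ℤ)).comp Perm.sign

theorem complexSign_swap {x y : ι} (h : x ≠ y) : complexSign ι (swap x y) = -1 := by
  simp [complexSign, Perm.sign_swap h]

theorem toGroupAlgebra_descension (k n : ℕ) : toGroupAlgebra (descension k n) =
    subsetSum (MonoidAlgebra.of ℂ (Perm (Fin k))) (complexSign (Fin k))
      (fun t => 1 / (n.descFactorial t : ℂ)) univ := by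
  rw [← toGroupAlgebra_of_fixCount]
  rfl

theorem toGroupAlgebra_ascension (k n : ℕ) : toGroupAlgebra (ascension k n) =
    subsetSum (MonoidAlgebra.of ℂ (Perm (Fin k))) 1
      (fun t => (-1) ^ t * (1 / (n.ascFactorial t : ℂ))) univ := by
  rw [← toGroupAlgebra_of_fixCount]
  congr 1
  ext σ
  simp only [ascension, MonoidHom.one_apply, one_mul]
  exact sum_congr rfl fun t _ => by ring

theorem descension_recursion {n : ℕ} {S : Finset ι} {x : ι} (hx : x ∉ S) (hS : S.card < n) :
    ((n : ℂ) • 1 + jucysMurphy (MonoidAlgebra.of ℂ (Perm ι)) x S) *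
      subsetSum (MonoidAlgebra.of ℂ (Perm ι)) (complexSign ι)
        (fun t => 1 / (n.descFactorial t : ℂ)) (insert x S) =
    (((n + 1 : ℕ) : ℂ) • 1 + jucysMurphy (MonoidAlgebra.of ℂ (Perm ι)) x S) *
      subsetSum (MonoidAlgebra.of ℂ (Perm ι)) (complexSign ι)
        (fun t => 1 / (n.descFactorial t : ℂ)) S := by
  -- With ε = -1 and z = n the factor z - εJ is n + J. The bound |S| < n keeps n - t nonzero for all
  -- t ≤ |S|.
  have h := subsetSum_recursion (MonoidAlgebra.of ℂ (Perm ι)) (complexSign ι) (ε := -1)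
    (by norm_num) (fun a b hab => complexSign_swap hab)
    (w := fun t => 1 / (n.descFactorial t : ℂ)) (z := n) hx (fun t ht => by
      have htn : t < n := ht.trans_lt hS
      have h0 : (n : ℂ) - t ≠ 0 := by
        rw [← Nat.cast_sub htn.le, Nat.cast_ne_zero]
        omega
      have h1 : (n.descFactorial t : ℂ) ≠ 0 := by
        rw [Nat.cast_ne_zero, Ne, Nat.descFactorial_eq_zero_iff_lt]
        omega
      rw [Nat.descFactorial_succ, Nat.cast_mul, Nat.cast_sub htn.le]
      field_simp)
  simpa only [neg_smul, one_smul, sub_neg_eq_add, Nat.cast_add, Nat.cast_one] using h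

theorem ascension_recursion (n : ℕ) {S : Finset ι} {x : ι} (hx : x ∉ S) :
    (((n + 1 : ℕ) : ℂ) • 1 + jucysMurphy (MonoidAlgebra.of ℂ (Perm ι)) x S) *
      subsetSum (MonoidAlgebra.of ℂ (Perm ι)) 1
        (fun t => (-1) ^ t * (1 / ((n + 1).ascFactorial t : ℂ))) (insert x S) =
    ((n : ℂ) • 1 + jucysMurphy (MonoidAlgebra.of ℂ (Perm ι)) x S) *
      subsetSum (MonoidAlgebra.of ℂ (Perm ι)) 1
        (fun t => (-1) ^ t * (1 / ((n + 1).ascFactorial t : ℂ))) S := by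
  -- With ε = 1 and z = -(n + 1) both linear factors are the negatives of those wanted.
  have h := subsetSum_recursion (MonoidAlgebra.of ℂ (Perm ι)) 1 (ε := 1)
    (by norm_num) (fun a b hab => rfl)
    (w := fun t => (-1) ^ t * (1 / ((n + 1).ascFactorial t : ℂ)))
    (z := -((n + 1 : ℕ) : ℂ)) hx (fun t ht => by
      have h0 : ((n : ℂ) + 1 + t) ≠ 0 := by
        exact_mod_cast Nat.succ_ne_zero (n + t) ∘ fun h => by omega
      have h1 : ((n + 1).ascFactorial t : ℂ) ≠ 0 :=
        Nat.cast_ne_zero.2 (Nat.ascFactorial_pos n t).ne'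
      rw [Nat.ascFactorial_succ, Nat.cast_mul]
      push_cast
      field_simp
      ring)
  have e1 : ∀ J : MonoidAlgebra ℂ (Perm ι),
      -((n + 1 : ℕ) : ℂ) • (1 : MonoidAlgebra ℂ (Perm ι)) - (1 : ℂ) • J =
        -(((n + 1 : ℕ) : ℂ) • 1 + J) := fun J => by module
  have e2 : ∀ J : MonoidAlgebra ℂ (Perm ι),
      (-((n + 1 : ℕ) : ℂ) + 1) • (1 : MonoidAlgebra ℂ (Perm ι)) - (1 : ℂ) • J =
        -((n : ℂ) • 1 + J) := fun J => by push_cast; module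
  rw [e1, e2, neg_mul, neg_mul] at h
  exact neg_injective h

/-- The two recursions carry the same factors n + J and n + 1 + J in opposite roles. Both commute
with D_S, so (n + J) D_{S'} A_{S'} = (n + J) D_S A_S, and n + J is cancelled. -/
theorem subsetSum_descension_mul_ascension {n : ℕ} {r : ι → Fin n} (hr : Function.Injective r)
    (S : Finset ι) :
    subsetSum (MonoidAlgebra.of ℂ (Perm ι)) (complexSign ι)
        (fun t => 1 / (n.descFactorial t : ℂ)) S *
      subsetSum (MonoidAlgebra.of ℂ (Perm ι)) 1
        (fun t => (-1) ^ t * (1 / ((n + 1).ascFactorial t : ℂ))) S = 1 := by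
  induction S using Finset.induction_on with
  | empty => rw [subsetSum_empty _ _ (by simp), subsetSum_empty _ _ (by simp), one_mul]
  | insert x S hx ih =>
    have hcard : S.card < n := by
      have h1 := card_le_univ ((insert x S).image r)
      rw [card_image_of_injective _ hr, card_insert_of_notMem hx, Fintype.card_fin] at h1
      omega
    apply (isUnit_add_jucysMurphy hr hx).mul_left_cancel
    have hcomm : ∀ c : ℂ, Commute (c • 1 + jucysMurphy (MonoidAlgebra.of ℂ (Perm ι)) x S)
        (subsetSum (MonoidAlgebra.of ℂ (Perm ι)) (complexSign ι)
          (fun t => 1 / (n.descFactorial t : ℂ)) S) := fun c =>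
      ((Commute.one_left _).smul_left c).add_left (commute_jucysMurphy_subsetSum _ _ _ hx)
    rw [← mul_assoc, descension_recursion hx hcard, (hcomm _).eq, mul_assoc,
      ascension_recursion n hx, ← mul_assoc, ← (hcomm _).eq, mul_assoc, ih]

/-- Multiplied by n + J, the right side for S' becomes D_S (n + 1 + J) Wg_{n+1,S'} = D_S Wg_{n+1,S},
while the left side becomes Wg_{n,S}. -/
theorem weingartenOn_eq_descension_mul {n : ℕ} {r : ι → Fin n} (hr : Function.Injective r)
    {r' : ι → Fin (n + 1)} (hr' : Function.Injective r') (S : Finset ι) :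
    toGroupAlgebra (weingartenOn r S) =
      subsetSum (MonoidAlgebra.of ℂ (Perm ι)) (complexSign ι)
        (fun t => 1 / (n.descFactorial t : ℂ)) S * toGroupAlgebra (weingartenOn r' S) := by
  induction S using Finset.induction_on with
  | empty =>
    rw [subsetSum_empty _ _ (by simp), toGroupAlgebra_weingartenOn_empty,
      toGroupAlgebra_weingartenOn_empty, one_mul]
  | insert x S hx ih =>
    have hcard : S.card < n := by
      have h1 := card_le_univ ((insert x S).image r)
      rw [card_image_of_injective _ hr, card_insert_of_notMem hx, Fintype.card_fin] at h1
      omega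
    apply (isUnit_add_jucysMurphy hr hx).mul_left_cancel
    have hcomm : Commute
        (((n + 1 : ℕ) : ℂ) • 1 + jucysMurphy (MonoidAlgebra.of ℂ (Perm ι)) x S)
        (subsetSum (MonoidAlgebra.of ℂ (Perm ι)) (complexSign ι)
          (fun t => 1 / (n.descFactorial t : ℂ)) S) :=
      ((Commute.one_left _).smul_left _).add_left (commute_jucysMurphy_subsetSum _ _ _ hx)
    rw [← mul_assoc, descension_recursion hx hcard, hcomm.eq, mul_assoc,
      toGroupAlgebra_weingartenOn_recursion hr hx, toGroupAlgebra_weingartenOn_recursion hr' hx, ih]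

theorem weingarten_eq_weingartenOn (k n : ℕ) (h : k ≤ n) :
    weingarten k n h = weingartenOn (Fin.castLE h) univ := by
  ext π
  rw [weingartenOn, if_pos (by simp [mem_permsOn])]
  rfl

end GroupAlgebra

end WgCalc

theorem mainTheorem5 (k n : ℕ) (hk : 1 ≤ k) (hkn : k ≤ n) :
    WgCalc.conv (WgCalc.ascension k (n + 1)) (WgCalc.descension k n) = WgCalc.diracId k ∧
      WgCalc.weingarten k n hkn =
        WgCalc.conv (WgCalc.descension k n)
          (WgCalc.weingarten k (n + 1) (hkn.trans (Nat.le_succ n))) := by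
  constructor
  · apply WgCalc.toGroupAlgebra_injective
    rw [WgCalc.toGroupAlgebra_conv, WgCalc.toGroupAlgebra_diracId,
      WgCalc.toGroupAlgebra_ascension, WgCalc.toGroupAlgebra_descension]
    -- The induction yields D * A = 1; one-sided inverses in the group algebra are two-sided, which
    -- gives the order A * D.
    exact IsDedekindFiniteMonoid.mul_eq_one_symm
      (WgCalc.subsetSum_descension_mul_ascension (Fin.castLE_injective hkn) Finset.univ)
  · apply WgCalc.toGroupAlgebra_injective
    rw [WgCalc.toGroupAlgebra_conv, WgCalc.toGroupAlgebra_descension,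
      WgCalc.weingarten_eq_weingartenOn, WgCalc.weingarten_eq_weingartenOn]
    exact WgCalc.weingartenOn_eq_descension_mul (Fin.castLE_injective hkn)
      (Fin.castLE_injective (hkn.trans (Nat.le_succ n))) Finset.univ
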